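/- All digraphs are finite. A tournament is a loopless digraph in which every two distinct vertices $x, y$ are joined by exactly one of the directed edges $xy$, $yx$. A directed path is a sequence $x_1 \ldots x_\ell$ of distinct vertices such that $x_i x_{i+1}$ is an edge for every $1 \le i \le \ell - 1$; $x_1$ is its initial vertex and $x_\ell$ its terminal vertex. A digraph is strongly connected if for any two distinct vertices $x$ and $y$ there is a directed path from $x$ to $y$, and it is strongly $m$-connected if it remains strongly connected upon removal of any set of at most $m-1$ vertices. The minimum out-degree of a digraph $D$ is denoted by $\delta^+(D)$. A digraph is $k$-linked if for any two disjoint sets $\{x_1, \ldots, x_k\}$ and $\{y_1, \ldots, y_k\}$ of $k$ vertices each there are pairwise vertex-disjoint directed paths $P_1, \ldots, P_k$ such that $P_i$ has initial vertex $x_i$ and terminal vertex $y_i$ for every $1 \le i \le k$. Theorem. For every positive integer $k$ there exists a natural number $f(k)$ such that every strongly $4k$-connected tournament $T$ with $\delta^+(T) \ge f(k)$ is $k$-linked. -/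

import Mathlib

namespace Digraph

variable {V : Type*}

/-- A tournament: no loops, and between any two distinct vertices exactly one of the two possible
directed edges is present. -/
def IsTournament (D : Digraph V) : Prop :=
  (∀ x, ¬ D.Adj x x) ∧ ∀ x y, x ≠ y → Xor (D.Adj x y) (D.Adj y x)

/-- `D.IsPath x y P`: the list `P` of distinct vertices is a directed path of `D` with initial
vertex `x` and terminal vertex `y`. -/
def IsPath (D : Digraph V) (x y : V) (P : List V) : Prop :=
  P.Nodup ∧ P.IsChain D.Adj ∧ P.head? = some x ∧ P.getLast? = some y

/-- The digraph obtained from `D` by removing the vertices in `S`. -/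
def removeVerts (D : Digraph V) (S : Finset V) : Digraph {v : V // v ∉ S} where
  Adj x y := D.Adj x y

/-- For any pair of distinct vertices `x`, `y` there is a directed path from `x` to `y`. -/
def StronglyConnected (D : Digraph V) : Prop :=
  ∀ x y, x ≠ y → ∃ P, D.IsPath x y P

/-- `D` remains strongly connected upon removal of any set of at most `k - 1` vertices. -/
def StronglyKConnected (D : Digraph V) (k : ℕ) : Prop :=
  ∀ S : Finset V, S.card < k → (D.removeVerts S).StronglyConnected

/-- For any disjoint sets of vertices `{x₁, …, x_k}` and `{y₁, …, y_k}` of size `k` there are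
pairwise vertex-disjoint directed paths `P₁, …, P_k`, with `P_i` going from `x_i` to `y_i`. -/
def KLinked (D : Digraph V) (k : ℕ) : Prop :=
  ∀ x y : Fin k → V, Function.Injective x → Function.Injective y → (∀ i j, x i ≠ y j) →
    ∃ P : Fin k → List V, (∀ i, D.IsPath (x i) (y i) (P i)) ∧
      ∀ i j, i ≠ j → (P i).Disjoint (P j)

/-- The out-degree of a vertex (of a finite digraph). -/
noncomputable def outDegree (D : Digraph V) (v : V) : ℕ :=
  {w | D.Adj v w}.ncard

/-- The minimum out-degree of a (finite) digraph, equal to `0` if there are no vertices. -/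
noncomputable def minOutDegree (D : Digraph V) : ℕ :=
  ⨅ v, D.outDegree v

end Digraph

namespace Digraph

variable {V : Type*}

/-! The idea is to link through a set `S` of `4k` vertices of least out-degree outside the
terminals. If `s` has out-degree at most that of `z`, and many out-neighbours of `s` are not
out-neighbours of `z`, then `z` has many out-neighbours that are not out-neighbours of `s`; these
send edges to `s`. So two extra vertices usually suffice to reach `s`
(`exists_path_of_outDegree_le`).

By Menger, `k` disjoint paths run from `S` to the `y i`, avoiding the `x i` and at most `k` reserved
vertices; this takes connectivity `3k`. Choose them of minimum total length and let `P` be their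
union. Any unused vertex of `S` is then a hub: it, and its out-neighbours off `P` and off the
avoided set, send edges to `P` only within the first three vertices of each path
(`IsLinkage.exists_minimal`). Hence short paths starting at a hub can be kept off `P`.

It remains to get from `x i` to a hub, or directly to the start `s i` of its path. If `x i` has more
than `k` out-neighbours dominating almost all of `S`, one can be reserved in advance as a bridge to
a hub. Without a reserved vertex, at most `k` out-neighbours of `x i` lie on `P` outside a small
set, and `exists_path_through_hub` applies. All connections have bounded length, so they can be
chosen greedily and disjointly. -/

/-! ### Degrees in tournaments. -/

theorem IsTournament.asymm {T : Digraph V} (hT : T.IsTournament) {u v : V} (h : T.Adj u v) :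
    ¬ T.Adj v u := by
  intro h'
  have hne : u ≠ v := by
    rintro rfl
    exact hT.1 _ h
  rcases hT.2 u v hne with ⟨_, h2⟩ | ⟨_, h2⟩
  · exact h2 h'
  · exact h2 h

theorem IsTournament.adj_of_not_adj {T : Digraph V} (hT : T.IsTournament) {u v : V}
    (hne : u ≠ v) (h : ¬ T.Adj u v) : T.Adj v u := by
  rcases hT.2 u v hne with ⟨h1, _⟩ | ⟨h1, _⟩
  · exact absurd h1 h
  · exact h1

/-- Every finite subset `N` of a tournament has a vertex with at least `(|N| - 1) / 2` in-neighbours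
in `N`. -/
theorem IsTournament.exists_large_inDegree [DecidableEq V] {T : Digraph V} [DecidableRel T.Adj]
    (hT : T.IsTournament) {N : Finset V} (hN : N.Nonempty) :
    ∃ z ∈ N, N.card ≤ 2 * (N.filter (fun w => T.Adj w z)).card + 1 := by
  by_contra! hcon
  have hsplit : ∀ z ∈ N, (N.filter (fun w => T.Adj w z)).card
      + (N.filter (fun w => T.Adj z w)).card + 1 = N.card := by
    intro z hz
    rw [← Finset.card_union_of_disjoint, ← Finset.card_erase_add_one hz]
    · congr 2
      ext w
      simp only [Finset.mem_union, Finset.mem_filter, Finset.mem_erase]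
      constructor
      · rintro (⟨h1, h2⟩ | ⟨h1, h2⟩)
        · exact ⟨by rintro rfl; exact hT.1 _ h2, h1⟩
        · exact ⟨by rintro rfl; exact hT.1 _ h2, h1⟩
      · rintro ⟨h1, h2⟩
        by_cases h : T.Adj w z
        · exact Or.inl ⟨h2, h⟩
        · exact Or.inr ⟨h2, hT.adj_of_not_adj h1 h⟩
    · rw [Finset.disjoint_filter]
      intro w _ h1 h2
      exact hT.asymm h1 h2
  -- Every edge inside `N` is counted once at its head and once at its tail, so in-degree cannot be
  -- below out-degree at every vertex.
  have hdouble : ∑ z ∈ N, (N.filter (fun w => T.Adj w z)).card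
      = ∑ z ∈ N, (N.filter (fun w => T.Adj z w)).card := by
    simp only [Finset.card_filter]
    exact Finset.sum_comm
  have hlt : ∑ z ∈ N, (N.filter (fun w => T.Adj w z)).card
      < ∑ z ∈ N, (N.filter (fun w => T.Adj z w)).card := by
    apply Finset.sum_lt_sum_of_nonempty hN
    intro z hz
    have h1 := hsplit z hz
    have h2 := hcon z hz
    omega
  omega

end Digraph

/-! ### Minimal and greedy selection of finite sets. -/

/-- Among the elements of `U`, one can select `m` elements minimizing a given function. -/
theorem Finset.exists_subset_card_eq_of_minimal {V : Type*} [DecidableEq V] (d : V → ℕ)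
    (U : Finset V) (m : ℕ) (hm : m ≤ U.card) :
    ∃ S ⊆ U, S.card = m ∧ ∀ s ∈ S, ∀ v ∈ U, v ∉ S → d s ≤ d v := by
  induction m with
  | zero => exact ⟨∅, by simp, rfl, by simp⟩
  | succ m ih =>
    obtain ⟨S, hSU, hcard, hS⟩ := ih (by omega)
    have hne : (U \ S).Nonempty := by
      rw [← Finset.card_pos, Finset.card_sdiff_of_subset hSU]
      omega
    obtain ⟨a, ha, hmin⟩ := Finset.exists_min_image (U \ S) d hne
    rw [Finset.mem_sdiff] at ha
    refine ⟨insert a S, Finset.insert_subset ha.1 hSU, by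
      rw [Finset.card_insert_of_notMem ha.2, hcard], ?_⟩
    intro s hs v hv hvS
    rw [Finset.mem_insert, not_or] at hvS
    rcases Finset.mem_insert.1 hs with rfl | hs
    · exact hmin v (Finset.mem_sdiff.2 ⟨hv, hvS.2⟩)
    · exact hS s hs v hv hvS.2

/-- If every index admits a set of size at most `c` with a given property avoiding any prescribed
set of size at most `c * |ι|`, then such sets can be chosen pairwise disjoint. -/
theorem Finset.exists_pairwise_disjoint_family {V ι : Type*} [DecidableEq V] [Fintype ι]
    (p : ι → Finset V → Prop) (c : ℕ)
    (h : ∀ i (W : Finset V), W.card ≤ c * Fintype.card ι →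
      ∃ l, p i l ∧ l.card ≤ c ∧ Disjoint l W) :
    ∃ l : ι → Finset V, (∀ i, p i (l i) ∧ (l i).card ≤ c) ∧
      ∀ i j, i ≠ j → Disjoint (l i) (l j) := by
  classical
  suffices H : ∀ I : Finset ι, ∃ l : ι → Finset V, (∀ i ∈ I, p i (l i) ∧ (l i).card ≤ c) ∧
      ∀ i ∈ I, ∀ j ∈ I, i ≠ j → Disjoint (l i) (l j) by
    obtain ⟨l, h1, h2⟩ := H Finset.univ
    exact ⟨l, fun i => h1 i (Finset.mem_univ i),
      fun i j => h2 i (Finset.mem_univ i) j (Finset.mem_univ j)⟩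
  intro I
  induction I using Finset.induction_on with
  | empty => exact ⟨fun _ => ∅, by simp, by simp⟩
  | insert a I ha ih =>
    obtain ⟨l, h1, h2⟩ := ih
    -- The forbidden set is the union of the sets already chosen.
    obtain ⟨la, hp, hc, hd⟩ := h a (I.biUnion l) (by
      calc (I.biUnion l).card ≤ I.card * c := Finset.card_biUnion_le_card_mul _ _ _
            (fun i hi => (h1 i hi).2)
        _ ≤ c * Fintype.card ι := by
            rw [mul_comm]
            exact Nat.mul_le_mul_left _ (Finset.card_le_univ I))
    rw [Finset.disjoint_biUnion_right] at hd
    have hval : ∀ i ∈ I, Function.update l a la i = l i := fun i hi =>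
      Function.update_of_ne (by rintro rfl; exact ha hi) _ _
    refine ⟨Function.update l a la, ?_, ?_⟩
    · intro i hi
      rcases Finset.mem_insert.1 hi with rfl | hi
      · rw [Function.update_self]
        exact ⟨hp, hc⟩
      · rw [hval i hi]
        exact h1 i hi
    · intro i hi j hj hij
      rcases Finset.mem_insert.1 hi with hia | hi' <;>
        rcases Finset.mem_insert.1 hj with hja | hj'
      · exact absurd (hia.trans hja.symm) hij
      · rw [hia, Function.update_self, hval j hj']
        exact hd j hj'
      · rw [hja, Function.update_self, hval i hi']
        exact (hd i hi').symm
      · rw [hval i hi', hval j hj']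
        exact h2 i hi' j hj' hij

/-! ### Menger's theorem by way of Hall's theorem. -/

namespace Digraph

variable {V : Type*}

theorem StronglyConnected.exists_adj_crossing {D : Digraph V} (hD : D.StronglyConnected)
    {p : V → Prop} {a b : V} (ha : ¬ p a) (hb : p b) : ∃ u v, ¬ p u ∧ p v ∧ D.Adj u v := by
  obtain ⟨P, -, hchain, hhead, hlast⟩ := hD a b (by rintro rfl; exact ha hb)
  by_contra! hcon
  induction P generalizing a with
  | nil => simp at hhead
  | cons c P ih =>
    obtain rfl : c = a := by simpa using hhead
    cases P with
    | nil =>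
      obtain rfl : c = b := by simpa using hlast
      exact ha hb
    | cons d P =>
      rw [List.isChain_cons_cons] at hchain
      exact ih (fun hd => hcon c d ha hd hchain.1) hchain.2 (by simp) (by simpa using hlast)

/-- Backward orbits under an injective predecessor map, followed until they enter `A`, are disjoint
paths. -/
theorem exists_disjoint_paths_of_injOn [Finite V] (D : Digraph V) (F A : Finset V) {ι : Type*}
    (y : ι → V) (hy : Function.Injective y) (hyF : ∀ j, y j ∉ F) (G : V → V)
    (hinj : ∀ u v, u ∉ A → v ∉ A → G u = G v → u = v) (hGy : ∀ u, u ∉ A → ∀ j, G u ≠ y j)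
    (hadj : ∀ u, u ∉ A → G u = u ∨ (D.Adj (G u) u ∧ G u ∉ F)) :
    ∃ Q : ι → List V, (∀ j, ∃ s ∈ A, D.IsPath s (y j) (Q j)) ∧ (∀ j, ∀ v ∈ Q j, v ∉ F) ∧
      ∀ i j, i ≠ j → (Q i).Disjoint (Q j) := by
  classical
  -- Cancel `G` from both sides until one side is some `y j`, which is not a value of `G` off `A`.
  -- So orbits neither meet nor revisit a vertex before entering `A`; in particular no fixed point
  -- of `G` occurs there, and finiteness forces entry.
  have hback : ∀ (a b : ℕ) (i j : ι), (∀ n < a, G^[n] (y i) ∉ A) → (∀ n < b, G^[n] (y j) ∉ A) →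
      G^[a] (y i) = G^[b] (y j) → a = b ∧ i = j := by
    intro a
    induction a with
    | zero =>
      intro b i j _ hb hab
      cases b with
      | zero => exact ⟨rfl, hy hab⟩
      | succ b =>
        rw [Function.iterate_succ_apply'] at hab
        exact absurd hab.symm (hGy _ (hb b (by omega)) i)
    | succ a ih =>
      intro b i j ha hb hab
      rw [Function.iterate_succ_apply'] at hab
      cases b with
      | zero => exact absurd hab (hGy _ (ha a (by omega)) j)
      | succ b =>
        rw [Function.iterate_succ_apply'] at hab
        have := ih b i j (fun n hn => ha n (by omega)) (fun n hn => hb n (by omega))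
          (hinj _ _ (ha a (by omega)) (hb b (by omega)) hab)
        exact ⟨by omega, this.2⟩
  have hex : ∀ j, ∃ n, G^[n] (y j) ∈ A := by
    intro j
    by_contra! hcon
    exact not_injective_infinite_finite (fun n : ℕ => G^[n] (y j)) fun a b hab =>
      (hback a b j j (fun n _ => hcon n) (fun n _ => hcon n) hab).1
  have hmin : ∀ j, ∀ n < Nat.find (hex j), G^[n] (y j) ∉ A := fun j n hn => Nat.find_min (hex j) hn
  have hF : ∀ j, ∀ n ≤ Nat.find (hex j), G^[n] (y j) ∉ F := by
    intro j n
    induction n with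
    | zero => exact fun _ => hyF j
    | succ n ih =>
      intro hn
      rw [Function.iterate_succ_apply']
      rcases hadj _ (hmin j n (by omega)) with h | h
      · rw [h]
        exact ih (by omega)
      · exact h.2
  refine ⟨fun j => ((List.range (Nat.find (hex j) + 1)).map fun n => G^[n] (y j)).reverse,
    fun j => ⟨_, Nat.find_spec (hex j), ?_, ?_, ?_, ?_⟩, ?_, ?_⟩
  · rw [List.nodup_reverse]
    refine List.Nodup.map_on ?_ List.nodup_range
    intro a ha b hb hab
    rw [List.mem_range] at ha hb
    exact (hback a b j j (fun n hn => hmin j n (by omega)) (fun n hn => hmin j n (by omega)) hab).1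
  · rw [List.isChain_reverse, List.isChain_map, List.isChain_range_succ]
    intro n hn
    have hne : G^[n.succ] (y j) ≠ G^[n] (y j) := fun h => by
      have := (hback _ _ j j (fun m hm => hmin j m (by omega)) (fun m hm => hmin j m (by omega)) h).1
      omega
    rw [Function.iterate_succ_apply'] at hne ⊢
    exact ((hadj _ (hmin j n hn)).resolve_left hne).1
  · simp [List.range_succ]
  · simp [List.range_succ_eq_map]
  · intro j v hv
    simp only [List.mem_reverse, List.mem_map, List.mem_range] at hv
    obtain ⟨n, hn, rfl⟩ := hv
    exact hF j n (by omega)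
  · intro i j hij v hi hj
    simp only [List.mem_reverse, List.mem_map, List.mem_range] at hi hj
    obtain ⟨a, ha, rfl⟩ := hi
    obtain ⟨b, hb, hab⟩ := hj
    exact hij (hback a b i j (fun n hn => hmin i n (by omega)) (fun n hn => hmin j n (by omega))
      hab.symm).2

/-- A form of Menger's theorem: in a strongly `(|F| + k)`-connected digraph, any `k` vertices `y j`
outside `F` are the ends of disjoint paths avoiding `F` and starting in a given `k`-set `A`. -/
theorem StronglyKConnected.exists_disjoint_paths [Finite V] {D : Digraph V} {F A : Finset V}
    {k : ℕ} (hD : D.StronglyKConnected (F.card + k)) (hAF : Disjoint A F) (hA : A.card = k)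
    (y : Fin k → V) (hy : Function.Injective y) (hyF : ∀ j, y j ∉ F) :
    ∃ Q : Fin k → List V, (∀ j, ∃ s ∈ A, D.IsPath s (y j) (Q j)) ∧ (∀ j, ∀ v ∈ Q j, v ∉ F) ∧
      ∀ i j, i ≠ j → (Q i).Disjoint (Q j) := by
  classical
  have := Fintype.ofFinite V
  set Y : Finset V := Finset.univ.image y with hYdef
  have hY : Y.card = k := by
    rw [hYdef, Finset.card_image_of_injective _ hy, Finset.card_fin]
  -- The candidates for the predecessor of `v`. Allowing `v` itself lets vertices off the paths stay
  -- put; removing `Y` makes the `y j` path ends.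
  let t : {v // v ∉ A} → Finset V := fun v =>
    insert v.1 (Finset.univ.filter fun u => D.Adj u v ∧ u ∉ F ∧ v.1 ∉ F) \ Y
  have hall : ∀ C : Finset {v // v ∉ A}, C.card ≤ (C.biUnion t).card := by
    intro C
    by_contra! hlt
    set C' : Finset V := C.map (Function.Embedding.subtype _) with hC'
    have hC'card : C'.card = C.card := Finset.card_map _
    set E : Finset V := C' ∪ Finset.univ.filter fun u => ∃ v ∈ C', D.Adj u v ∧ u ∉ F ∧ v ∉ F
    have hEt : C.biUnion t = E \ Y := by
      ext u
      simp only [t, E, hC', Finset.mem_biUnion, Finset.mem_sdiff, Finset.mem_insert,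
        Finset.mem_filter, Finset.mem_univ, true_and, Finset.mem_union, Finset.mem_map,
        Function.Embedding.subtype_apply]
      constructor
      · rintro ⟨v, hv, rfl | h, hu⟩
        · exact ⟨Or.inl ⟨v, hv, rfl⟩, hu⟩
        · exact ⟨Or.inr ⟨v.1, ⟨v, hv, rfl⟩, h⟩, hu⟩
      · rintro ⟨⟨v, hv, rfl⟩ | ⟨w, ⟨v, hv, rfl⟩, h⟩, hu⟩
        · exact ⟨v, hv, Or.inl rfl, hu⟩
        · exact ⟨v, hv, Or.inr h, hu⟩
    have hCE : C' ⊆ E := Finset.subset_union_left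
    -- A violation of Hall's condition yields a separator: every edge entering `C'` off `F` starts
    -- in `E`, and `|sep| = |E \ Y| - |C'| + k < k`.
    set sep : Finset V := (E \ C') ∪ (Y \ E)
    have hsep : sep.card < k := by
      have h1 : sep.card ≤ (E \ C').card + (Y \ E).card := Finset.card_union_le _ _
      have h2 : (E \ C').card + C'.card = E.card := Finset.card_sdiff_add_card_eq_card hCE
      have h3 : (E \ Y).card + (E ∩ Y).card = E.card := Finset.card_sdiff_add_card_inter _ _
      have h4 : (Y \ E).card + (Y ∩ E).card = Y.card := Finset.card_sdiff_add_card_inter _ _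
      rw [Finset.inter_comm] at h4
      rw [hEt] at hlt
      omega
    obtain ⟨a, haA, ha⟩ := Finset.exists_mem_notMem_of_card_lt_card (hsep.trans_eq hA.symm)
    obtain ⟨b, hbY, hb⟩ := Finset.exists_mem_notMem_of_card_lt_card (hsep.trans_eq hY.symm)
    have haF : a ∉ F := Finset.disjoint_left.1 hAF haA
    have hbF : b ∉ F := by
      obtain ⟨j, -, rfl⟩ := Finset.mem_image.1 hbY
      exact hyF j
    have haC : a ∉ C' := by
      intro h
      obtain ⟨v, -, hv⟩ := Finset.mem_map.1 h
      exact v.2 (by rw [← hv] at haA; exact haA)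
    have hbC : b ∈ C' := by
      by_contra h
      apply hb
      by_cases hbE : b ∈ E
      · exact Finset.mem_union_left _ (Finset.mem_sdiff.2 ⟨hbE, h⟩)
      · exact Finset.mem_union_right _ (Finset.mem_sdiff.2 ⟨hbY, hbE⟩)
    obtain ⟨u, v, hu, hv, huv⟩ := (hD (F ∪ sep)
        ((Finset.card_union_le _ _).trans_lt (by omega))).exists_adj_crossing
      (p := fun v => v.1 ∈ C') (a := ⟨a, by simp [haF, ha]⟩) (b := ⟨b, by simp [hbF, hb]⟩) haC hbC
    have huF := u.2
    have hvF := v.2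
    rw [Finset.mem_union, not_or] at huF hvF
    refine huF.2 (Finset.mem_union_left _ (Finset.mem_sdiff.2 ⟨?_, hu⟩))
    exact Finset.mem_union_right _ (Finset.mem_filter.2
      ⟨Finset.mem_univ _, v, hv, huv, huF.1, hvF.1⟩)
  obtain ⟨g, hg, hgt⟩ := (Finset.all_card_le_biUnion_card_iff_exists_injective t).1 hall
  simp only [t, Finset.mem_sdiff, Finset.mem_insert, Finset.mem_filter, Finset.mem_univ,
    true_and] at hgt
  refine exists_disjoint_paths_of_injOn D F A y hy hyF
    (fun v => if h : v ∉ A then g ⟨v, h⟩ else v) ?_ ?_ ?_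
  · intro u v hu hv huv
    simp only [hu, hv, not_false_eq_true, dite_true] at huv
    exact congrArg Subtype.val (hg huv)
  · intro u hu j huj
    simp only [hu, not_false_eq_true, dite_true] at huj
    exact (hgt ⟨u, hu⟩).2 (huj ▸ Finset.mem_image_of_mem y (Finset.mem_univ j))
  · intro u hu
    simp only [hu, not_false_eq_true, dite_true]
    rcases (hgt ⟨u, hu⟩).1 with h | h
    · exact Or.inl h
    · exact Or.inr ⟨h.1, h.2.1⟩

/-! ### Linkages of minimum total length. -/

theorem IsPath.of_append {D : Digraph V} {a b v : V} {l₁ l₂ : List V}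
    (h : D.IsPath a b (l₁ ++ v :: l₂)) : D.IsPath v b (v :: l₂) :=
  ⟨(List.nodup_append.1 h.1).2.1, h.2.1.right_of_append, by simp, by
    rw [← h.2.2.2, List.getLast?_append_of_ne_nil _ (by simp)]⟩

theorem IsPath.cons {D : Digraph V} {u v b : V} {L : List V} (h : D.IsPath v b L)
    (huv : D.Adj u v) (hu : u ∉ L) : D.IsPath u b (u :: L) := by
  obtain ⟨h1, h2, h3, h4⟩ := h
  refine ⟨List.nodup_cons.2 ⟨hu, h1⟩, h2.cons ?_, by simp, ?_⟩
  · intro w hw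
    rw [h3] at hw
    obtain rfl : v = w := by simpa using hw
    exact huv
  · cases L with
    | nil => simp at h3
    | cons c L => simpa using h4

/-- Disjoint paths from `S` to the vertices `y j`, avoiding `F`. -/
structure IsLinkage (D : Digraph V) (F S : Finset V) {k : ℕ} (y : Fin k → V)
    (Q : Fin k → List V) : Prop where
  path : ∀ j, ∃ s ∈ S, D.IsPath s (y j) (Q j)
  avoid : ∀ j, ∀ v ∈ Q j, v ∉ F
  disjoint : ∀ i j, i ≠ j → (Q i).Disjoint (Q j)

/-- Swapping `L` for `Q j` gives another linkage, and all other terms of the two total lengths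
cancel. -/
theorem IsLinkage.length_le {D : Digraph V} {F S : Finset V} {k : ℕ} {y : Fin k → V}
    {Q : Fin k → List V} (hQ : D.IsLinkage F S y Q)
    (hmin : ∀ Q', D.IsLinkage F S y Q' → ∑ j, (Q j).length ≤ ∑ j, (Q' j).length)
    {j : Fin k} {s : V} {L : List V} (hs : s ∈ S) (hL : D.IsPath s (y j) L)
    (hLF : ∀ v ∈ L, v ∉ F) (hdisj : ∀ i, i ≠ j → ∀ v ∈ L, v ∉ Q i) :
    (Q j).length ≤ L.length := by
  classical
  have hlink : D.IsLinkage F S y (Function.update Q j L) := by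
    refine ⟨fun i => ?_, fun i => ?_, fun i i' hii' => ?_⟩
    · rcases eq_or_ne i j with rfl | hi
      · rw [Function.update_self]
        exact ⟨s, hs, hL⟩
      · rw [Function.update_of_ne hi]
        exact hQ.path i
    · rcases eq_or_ne i j with rfl | hi
      · rw [Function.update_self]
        exact hLF
      · rw [Function.update_of_ne hi]
        exact hQ.avoid i
    · rcases eq_or_ne i j with rfl | hi
      · rw [Function.update_self, Function.update_of_ne hii'.symm]
        exact fun v hv hv' => hdisj i' hii'.symm v hv hv'
      · rw [Function.update_of_ne hi]
        rcases eq_or_ne i' j with rfl | hi'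
        · rw [Function.update_self]
          exact fun v hv hv' => hdisj i hi v hv' hv
        · rw [Function.update_of_ne hi']
          exact hQ.disjoint i i' hii'
  have h := hmin _ hlink
  have hrest : ∑ i ∈ Finset.univ.erase j, (Function.update Q j L i).length
      = ∑ i ∈ Finset.univ.erase j, (Q i).length :=
    Finset.sum_congr rfl fun i hi => by rw [Function.update_of_ne (Finset.ne_of_mem_erase hi)]
  rw [← Finset.add_sum_erase _ _ (Finset.mem_univ j),
    ← Finset.add_sum_erase _ (fun i => (Function.update Q j L i).length) (Finset.mem_univ j),
    Function.update_self, hrest] at h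
  omega

theorem _root_.List.mem_take_append_cons {l₁ l₂ : List V} {v : V} {n : ℕ} (h : l₁.length < n) :
    v ∈ (l₁ ++ v :: l₂).take n := by
  obtain ⟨m, hm⟩ : ∃ m, n - l₁.length = m + 1 := ⟨n - l₁.length - 1, by omega⟩
  rw [List.take_append, hm, List.take_succ_cons]
  simp

/-- A linkage of minimum total length meets `S` only in its initial vertices, and a walk of length
at most two from an unused vertex of `S` reaches it only within the first three vertices of its
paths. -/
theorem IsLinkage.exists_minimal {D : Digraph V} {F S : Finset V} {k : ℕ} {y : Fin k → V}
    {Q₀ : Fin k → List V} (hQ₀ : D.IsLinkage F S y Q₀) (hSF : Disjoint S F) :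
    ∃ Q, D.IsLinkage F S y Q ∧
      (∀ j, ∀ v ∈ Q j, v ∈ S → (Q j).head? = some v) ∧
      (∀ s ∈ S, (∀ j, s ∉ Q j) → ∀ j, ∀ v ∈ Q j, D.Adj s v → v ∈ (Q j).take 3) ∧
      ∀ s ∈ S, (∀ j, s ∉ Q j) → ∀ z, z ≠ s → z ∉ F → (∀ j, z ∉ Q j) → D.Adj s z →
        ∀ j, ∀ v ∈ Q j, D.Adj z v → v ∈ (Q j).take 3 := by
  classical
  have hex : ∃ n, ∃ Q, D.IsLinkage F S y Q ∧ ∑ j, (Q j).length = n := ⟨_, Q₀, hQ₀, rfl⟩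
  obtain ⟨Q, hQ, hQn⟩ := Nat.find_spec hex
  have hmin : ∀ Q', D.IsLinkage F S y Q' → ∑ j, (Q j).length ≤ ∑ j, (Q' j).length := by
    intro Q' hQ'
    rw [hQn]
    exact Nat.find_min' hex ⟨Q', hQ', rfl⟩
  have hsub : ∀ j l₁ v l₂, Q j = l₁ ++ v :: l₂ → D.IsPath v (y j) (v :: l₂) ∧
      (∀ w ∈ v :: l₂, w ∉ F) ∧ (∀ i, i ≠ j → ∀ w ∈ v :: l₂, w ∉ Q i) ∧
      ∀ w ∈ v :: l₂, w ∈ Q j := by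
    intro j l₁ v l₂ hj
    have hmem : ∀ w ∈ v :: l₂, w ∈ Q j := fun w hw => by
      rw [hj]
      exact List.mem_append_right _ hw
    obtain ⟨s, -, hs⟩ := hQ.path j
    rw [hj] at hs
    exact ⟨hs.of_append, fun w hw => hQ.avoid j w (hmem w hw),
      fun i hi w hw hwi => hQ.disjoint i j hi hwi (hmem w hw), hmem⟩
  refine ⟨Q, hQ, ?_, ?_, ?_⟩
  · intro j v hv hvS
    obtain ⟨l₁, l₂, hj⟩ := List.mem_iff_append.1 hv
    obtain ⟨h1, h2, h3, -⟩ := hsub j l₁ v l₂ hj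
    have := hQ.length_le hmin hvS h1 h2 h3
    rw [hj, List.length_append] at this
    obtain rfl : l₁ = [] := List.length_eq_zero_iff.1 (by omega)
    rw [hj]
    simp
  · intro s hs hsQ j v hv hsv
    obtain ⟨l₁, l₂, hj⟩ := List.mem_iff_append.1 hv
    obtain ⟨h1, h2, h3, h4⟩ := hsub j l₁ v l₂ hj
    -- The detour has `|l₂| + 2` vertices against `|l₁| + 1 + |l₂|`, so `|l₁| ≤ 1`.
    have := hQ.length_le hmin hs (h1.cons hsv fun h => hsQ j (h4 s h))
      (List.forall_mem_cons.2 ⟨Finset.disjoint_left.1 hSF hs, h2⟩)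
      fun i hi => List.forall_mem_cons.2 ⟨hsQ i, h3 i hi⟩
    rw [hj, List.length_append, List.length_cons, List.length_cons, List.length_cons] at this
    rw [hj]
    exact List.mem_take_append_cons (by omega)
  · intro s hs hsQ z hzs hzF hzQ hsz j v hv hzv
    obtain ⟨l₁, l₂, hj⟩ := List.mem_iff_append.1 hv
    obtain ⟨h1, h2, h3, h4⟩ := hsub j l₁ v l₂ hj
    -- One more vertex on the detour gives `|l₁| ≤ 2`, whence the three in `take 3`.
    have := hQ.length_le hmin hs ((h1.cons hzv fun h => hzQ j (h4 z h)).cons hsz (by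
        rw [List.mem_cons, not_or]
        exact ⟨hzs.symm, fun h => hsQ j (h4 s h)⟩))
      (List.forall_mem_cons.2 ⟨Finset.disjoint_left.1 hSF hs, List.forall_mem_cons.2 ⟨hzF, h2⟩⟩)
      fun i hi => List.forall_mem_cons.2 ⟨hsQ i, List.forall_mem_cons.2 ⟨hzQ i, h3 i hi⟩⟩
    rw [hj, List.length_append, List.length_cons, List.length_cons, List.length_cons,
      List.length_cons] at this
    rw [hj]
    exact List.mem_take_append_cons (by omega)

/-! ### Short connections into a vertex of small out-degree. -/

theorem outDegree_eq_card [Fintype V] (D : Digraph V) [DecidableRel D.Adj] (v : V) :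
    D.outDegree v = (Finset.univ.filter fun w => D.Adj v w).card := by
  classical
  rw [outDegree, Set.ncard_eq_toFinset_card']
  congr 1
  ext w
  simp

/-- If `s` has minimum out-degree among the vertices outside `W`, then a vertex with many
out-neighbours, whose own out-neighbours in `P` all lie in `W`, is joined to `s` by a path with at
most two inner vertices, all outside `W ∪ P`. -/
theorem IsTournament.exists_path_of_outDegree_le [Finite V] {T : Digraph V} (hT : T.IsTournament)
    {P W N : Finset V} {u s : V} (hs : s ∈ W)
    (hdeg : ∀ z, z ∉ W → T.outDegree s ≤ T.outDegree z)
    (hN : ∀ z ∈ N, T.Adj u z ∧ z ∉ W ∧ z ∉ P) (hout : ∀ z ∈ N, ∀ v ∈ P, T.Adj z v → v ∈ W)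
    (hcard : 2 * W.card + 2 ≤ N.card) :
    ∃ l : List V, l.Nodup ∧ l.length ≤ 2 ∧ (∀ v ∈ l, v ∉ W ∧ v ∉ P) ∧
      (u :: (l ++ [s])).IsChain T.Adj := by
  classical
  have := Fintype.ofFinite V
  have hne : ∀ z, z ∉ W → z ≠ s := by
    rintro z hz rfl
    exact hz hs
  by_cases hdirect : ∃ z ∈ N, T.Adj z s
  · obtain ⟨z, hz, hzs⟩ := hdirect
    obtain ⟨h1, h2, h3⟩ := hN z hz
    exact ⟨[z], by simp, by simp, by simp [h2, h3], by simp [h1, hzs]⟩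
  push Not at hdirect
  obtain ⟨z, hz, hzin⟩ := hT.exists_large_inDegree (Finset.card_pos.1 (by omega : 0 < N.card))
  obtain ⟨huz, hzW, hzP⟩ := hN z hz
  set Os := Finset.univ.filter fun w => T.Adj s w with hOs
  set Oz := Finset.univ.filter fun w => T.Adj z w with hOz
  set I := N.filter fun w => T.Adj w z with hI
  have hinsert : insert z I ⊆ Os := by
    intro w hw
    have hwN : w ∈ N := by
      rcases Finset.mem_insert.1 hw with rfl | hw
      · exact hz
      · exact (Finset.mem_filter.1 hw).1
    exact Finset.mem_filter.2 ⟨Finset.mem_univ _,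
      hT.adj_of_not_adj (hne w (hN w hwN).2.1) (hdirect w hwN)⟩
  have hzI : z ∉ I := fun h => hT.1 z (Finset.mem_filter.1 h).2
  -- `insert z I` lies in `Os` and misses `Oz`. As `|Os| ≤ |Oz|`, at least `|I| + 1 > |W|` vertices
  -- lie in `Oz \ Os`.
  have h1 : (Oz ∩ Os).card + (I.card + 1) ≤ Os.card := by
    rw [← Finset.card_insert_of_notMem hzI, ← Finset.card_union_of_disjoint]
    · exact Finset.card_le_card (Finset.union_subset Finset.inter_subset_right hinsert)
    · rw [Finset.disjoint_left]
      intro w hw hw'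
      have hzw : T.Adj z w := (Finset.mem_filter.1 (Finset.mem_inter.1 hw).1).2
      rcases Finset.mem_insert.1 hw' with rfl | hw'
      · exact hT.1 _ hzw
      · exact hT.asymm hzw (Finset.mem_filter.1 hw').2
  have h2 : (Oz \ Os).card + (Oz ∩ Os).card = Oz.card := Finset.card_sdiff_add_card_inter _ _
  have h3 : Os.card ≤ Oz.card := by
    have := hdeg z hzW
    rwa [outDegree_eq_card, outDegree_eq_card] at this
  obtain ⟨w, hw, hwW⟩ := Finset.exists_mem_notMem_of_card_lt_card
    (by omega : W.card < (Oz \ Os).card)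
  rw [Finset.mem_sdiff, hOz, hOs, Finset.mem_filter, Finset.mem_filter] at hw
  have hzw : T.Adj z w := hw.1.2
  have hws : T.Adj w s :=
    hT.adj_of_not_adj (hne w hwW).symm fun h => hw.2 ⟨Finset.mem_univ _, h⟩
  refine ⟨[z, w], ?_, by simp, ?_, by simp [huz, hzw, hws]⟩
  · simp only [List.nodup_cons, List.mem_singleton, List.not_mem_nil, not_false_eq_true,
      List.nodup_nil, and_true]
    rintro rfl
    exact hT.1 _ hzw
  · simp only [List.mem_cons, List.not_mem_nil, or_false, forall_eq_or_imp, forall_eq]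
    exact ⟨⟨hzW, hzP⟩, hwW, fun hwP => hwW (hout z hz w hwP hzw)⟩

/-- Here `t` plays an unused vertex of `S`. Its out-neighbours outside `W` avoid `P`, and at least
`2|W| + 2` of them remain. -/
theorem IsTournament.exists_path_from_hub [Finite V] {T : Digraph V} (hT : T.IsTournament)
    {P W : Finset V} {t s : V} (hs : s ∈ W)
    (hdeg : ∀ z, z ∉ W → T.outDegree s ≤ T.outDegree z)
    (ht : ∀ v ∈ P, T.Adj t v → v ∈ W)
    (ht' : ∀ z, z ∉ P → z ∉ W → T.Adj t z → ∀ v ∈ P, T.Adj z v → v ∈ W)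
    (hcard : 3 * W.card + 2 ≤ T.outDegree t) :
    ∃ l : List V, l.Nodup ∧ l.length ≤ 2 ∧ (∀ v ∈ l, v ∉ W ∧ v ∉ P) ∧
      (t :: (l ++ [s])).IsChain T.Adj := by
  classical
  have := Fintype.ofFinite V
  rw [outDegree_eq_card] at hcard
  have hN : ∀ z ∈ (Finset.univ.filter fun w => T.Adj t w) \ W, T.Adj t z ∧ z ∉ W ∧ z ∉ P := by
    intro z hz
    rw [Finset.mem_sdiff, Finset.mem_filter] at hz
    exact ⟨hz.1.2, hz.2, fun hzP => hz.2 (ht z hzP hz.1.2)⟩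
  refine hT.exists_path_of_outDegree_le hs hdeg hN
    (fun z hz => ht' z (hN z hz).2.2 (hN z hz).2.1 (hN z hz).1) ?_
  have := Finset.le_card_sdiff W (Finset.univ.filter fun w => T.Adj t w)
  omega

/-- This serves an `x` without a reserved vertex. Either an out-neighbour of `x` off `P ∪ W` leads
to the hub `t`, or `t` dominates all of them; they then inherit `ht'` and can replace the
out-neighbours of `t`. -/
theorem IsTournament.exists_path_through_hub [Finite V] {T : Digraph V} (hT : T.IsTournament)
    {P W : Finset V} {x t s : V} {k : ℕ} (hx : x ∈ W) (hxt : x ≠ t) (htW : t ∈ W) (hs : s ∈ W)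
    (hdeg : ∀ z, z ∉ W → T.outDegree s ≤ T.outDegree z)
    (ht : ∀ v ∈ P, T.Adj t v → v ∈ W)
    (ht' : ∀ z, z ∉ P → z ∉ W → T.Adj t z → ∀ v ∈ P, T.Adj z v → v ∈ W)
    (hxP : {v | T.Adj x v ∧ v ∈ P ∧ v ∉ W}.ncard ≤ k)
    (hcard : 3 * W.card + 5 ≤ T.outDegree t) (hcardx : 3 * W.card + k + 5 ≤ T.outDegree x) :
    ∃ l : Finset V, l.card ≤ 3 ∧ (∀ v ∈ l, v ∉ W ∧ v ∉ P) ∧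
      ∃ M : List V, M.Nodup ∧ M.head? = some x ∧ (M ++ [s]).IsChain T.Adj ∧
        ∀ v ∈ M, v ∈ l ∨ v = x ∨ v = t := by
  classical
  have := Fintype.ofFinite V
  rw [outDegree_eq_card] at hcardx
  set O := Finset.univ.filter fun w => T.Adj x w with hO
  set A := Finset.univ.filter fun v => T.Adj x v ∧ v ∈ P ∧ v ∉ W with hA
  have hAk : A.card ≤ k := by
    rw [Set.ncard_eq_toFinset_card'] at hxP
    refine le_trans (le_of_eq ?_) hxP
    congr 1
    ext w
    simp [hA]
  have hN : ∀ z ∈ O \ (A ∪ W), T.Adj x z ∧ z ∉ W ∧ z ∉ P := by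
    intro z hz
    simp only [hO, hA, Finset.mem_sdiff, Finset.mem_union, Finset.mem_filter, Finset.mem_univ,
      true_and, not_or] at hz
    exact ⟨hz.1, hz.2.2, fun hzP => hz.2.1 ⟨hz.1, hzP, hz.2.2⟩⟩
  by_cases hdirect : ∃ z ∈ O \ (A ∪ W), T.Adj z t
  · obtain ⟨z, hz, hzt⟩ := hdirect
    obtain ⟨hxz, hzW, hzP⟩ := hN z hz
    -- Adding `z` to `W` keeps the second leg off `z` and accounts for the `5 = 3 + 2` in `hcard`.
    obtain ⟨l, hl, hlen, hlW, hchain⟩ := hT.exists_path_from_hub (P := P) (W := insert z W)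
      (Finset.mem_insert_of_mem hs)
      (fun w hw => hdeg w fun h => hw (Finset.mem_insert_of_mem h))
      (fun v hv h => Finset.mem_insert_of_mem (ht v hv h))
      (fun w hwP hwW htw v hv hwv => Finset.mem_insert_of_mem
        (ht' w hwP (fun h => hwW (Finset.mem_insert_of_mem h)) htw v hv hwv))
      (by rw [Finset.card_insert_of_notMem hzW]; omega)
    have hlz : z ∉ l := fun h => (hlW z h).1 (Finset.mem_insert_self z W)
    have hlW' : ∀ w ∈ W, w ∉ l := fun w hw h => (hlW w h).1 (Finset.mem_insert_of_mem hw)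
    refine ⟨insert z l.toFinset, ?_, ?_, x :: z :: t :: l, ?_, rfl, ?_, ?_⟩
    · have := Finset.card_insert_le z l.toFinset
      have := l.toFinset_card_le
      omega
    · intro v hv
      rcases Finset.mem_insert.1 hv with rfl | hv
      · exact ⟨hzW, hzP⟩
      · have := hlW v (List.mem_toFinset.1 hv)
        exact ⟨fun h => this.1 (Finset.mem_insert_of_mem h), this.2⟩
    · have hxz' : x ≠ z := by rintro rfl; exact hzW hx
      have hzt' : z ≠ t := by rintro rfl; exact hzW htW
      simp [hxz', hxt, hzt', hl, hlz, hlW' x hx, hlW' t htW]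
    · simpa [hxz, hzt] using hchain
    · intro v hv
      simp only [List.mem_cons] at hv
      rcases hv with rfl | rfl | rfl | hv
      · simp
      · simp
      · simp
      · simp [hv]
  · push Not at hdirect
    obtain ⟨l, hl, hlen, hlW, hchain⟩ := hT.exists_path_of_outDegree_le hs hdeg hN
      (fun z hz => ht' z (hN z hz).2.2 (hN z hz).2.1
        (hT.adj_of_not_adj (by rintro rfl; exact (hN _ hz).2.1 htW) (hdirect z hz))) (by
        have := Finset.le_card_sdiff (A ∪ W) O
        have := Finset.card_union_le A W
        omega)
    refine ⟨l.toFinset, l.toFinset_card_le.trans (by omega),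
      fun v hv => hlW v (List.mem_toFinset.1 hv), x :: l,
      List.nodup_cons.2 ⟨fun h => (hlW x h).1 hx, hl⟩, rfl, hchain, ?_⟩
    intro v hv
    rcases List.mem_cons.1 hv with rfl | hv
    · simp
    · simp [hv]

/-! ### Assembling the linkage. -/

set_option maxHeartbeats 800000 in
/-- A tournament that is strongly `3k`-connected with all out-degrees at least `100k` is `k`-linked. -/
theorem IsTournament.kLinked_of_stronglyKConnected [Finite V] {T : Digraph V}
    (hT : T.IsTournament) {k : ℕ} (hk : 0 < k) (hcon : T.StronglyKConnected (3 * k))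
    (hdeg : ∀ v, 100 * k ≤ T.outDegree v) : T.KLinked k := by
  classical
  have := Fintype.ofFinite V
  intro x y hx hy hxy
  set X : Finset V := Finset.univ.image x
  set Y : Finset V := Finset.univ.image y
  have hxX : ∀ i, x i ∈ X := fun i => Finset.mem_image_of_mem x (Finset.mem_univ i)
  have hyY : ∀ i, y i ∈ Y := fun i => Finset.mem_image_of_mem y (Finset.mem_univ i)
  have hXcard : X.card ≤ k := Finset.card_image_le.trans (Finset.card_fin k).le
  have hYcard : Y.card ≤ k := Finset.card_image_le.trans (Finset.card_fin k).le
  have hyX : ∀ j, y j ∉ X := by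
    intro j h
    obtain ⟨i, -, hi⟩ := Finset.mem_image.1 h
    exact hxy i j hi
  -- `S` consists of vertices of smallest out-degree.
  obtain ⟨S, hSU, hScard, hSmin⟩ := Finset.exists_subset_card_eq_of_minimal T.outDegree
    (X ∪ Y)ᶜ (4 * k) (by
      have h1 := hdeg (x ⟨0, hk⟩)
      rw [outDegree_eq_card] at h1
      have h2 := Finset.card_le_univ (Finset.univ.filter fun w => T.Adj (x ⟨0, hk⟩) w)
      have h3 := Finset.card_union_le X Y
      rw [Finset.card_compl]
      omega)
  have hSX : ∀ s ∈ S, s ∉ X ∧ s ∉ Y := by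
    intro s hs
    simpa using hSU hs
  -- Out-neighbours of `x i` that send edges to almost all of `S`; one of them is reserved for `x i`
  -- whenever there are many.
  set A : Fin k → Finset V := fun i => Finset.univ.filter fun v => T.Adj (x i) v ∧
    v ∉ X ∧ v ∉ Y ∧ v ∉ S ∧ (S.filter fun s => ¬ T.Adj v s).card ≤ k with hA
  obtain ⟨ζ, hζ, hζdisj⟩ := Finset.exists_pairwise_disjoint_family
    (fun i l => (∃ z ∈ A i, l = {z}) ∨ (l = ∅ ∧ (A i).card ≤ k)) 1 (by
      intro i W hW
      rw [one_mul, Fintype.card_fin] at hW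
      by_cases h : A i ⊆ W
      · exact ⟨∅, Or.inr ⟨rfl, (Finset.card_le_card h).trans hW⟩, by simp, by simp⟩
      · obtain ⟨z, hz, hzW⟩ := Finset.not_subset.1 h
        exact ⟨{z}, Or.inl ⟨z, hz, rfl⟩, by simp, by simpa using hzW⟩)
  have hζA : ∀ i, ∀ z ∈ ζ i, z ∈ A i := by
    intro i z hz
    rcases (hζ i).1 with ⟨w, hw, h⟩ | ⟨h, -⟩
    · rw [h, Finset.mem_singleton] at hz
      exact hz ▸ hw
    · simp [h] at hz
  set Z : Finset V := Finset.univ.biUnion ζ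
  have hZcard : Z.card ≤ k := by
    have := Finset.card_biUnion_le_card_mul Finset.univ ζ 1 fun i _ => (hζ i).2
    simpa using this
  have hζZ : ∀ i, ζ i ⊆ Z := fun i => Finset.subset_biUnion_of_mem ζ (Finset.mem_univ i)
  have hZ : ∀ z ∈ Z, z ∉ X ∧ z ∉ Y ∧ z ∉ S := by
    intro z hz
    obtain ⟨i, -, hi⟩ := Finset.mem_biUnion.1 hz
    have := hζA i z hi
    simp only [hA, Finset.mem_filter] at this
    exact ⟨this.2.2.1, this.2.2.2.1, this.2.2.2.2.1⟩
  set F : Finset V := X ∪ Z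
  have hFcard : F.card ≤ 2 * k := (Finset.card_union_le _ _).trans (by omega)
  have hSF : Disjoint S F := by
    rw [Finset.disjoint_left]
    intro s hs hsF
    rcases Finset.mem_union.1 hsF with h | h
    · exact (hSX s hs).1 h
    · exact (hZ s h).2.2 hs
  -- A shortest linkage from `S` to `Y` avoiding `X` and the reserved vertices.
  obtain ⟨S₀, hS₀, hS₀card⟩ := Finset.exists_subset_card_eq (by omega : k ≤ S.card)
  obtain ⟨Q₀, hQ₀, hQ₀F, hQ₀disj⟩ := StronglyKConnected.exists_disjoint_paths (D := T) (F := F)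
    (A := S₀) (k := k) (fun C hC => hcon C (hC.trans_le (by omega)))
    (hSF.mono_left hS₀) hS₀card y hy (fun j h => by
      rcases Finset.mem_union.1 h with h | h
      · exact hyX j h
      · exact (hZ _ h).2.1 (hyY j))
  obtain ⟨Q, hQ, hQhead, hQone, hQtwo⟩ := IsLinkage.exists_minimal (D := T) (S := S)
    ⟨fun j => (hQ₀ j).imp fun s hs => ⟨hS₀ hs.1, hs.2⟩, hQ₀F, hQ₀disj⟩ hSF
  choose s hsS hsQ using hQ.path
  set P : Finset V := Finset.univ.biUnion fun j => (Q j).toFinset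
  have hP : ∀ v, v ∈ P ↔ ∃ j, v ∈ Q j := by simp [P]
  set P₃ : Finset V := Finset.univ.biUnion fun j => ((Q j).take 3).toFinset
  have hP₃ : ∀ j, ∀ v ∈ (Q j).take 3, v ∈ P₃ := fun j v hv =>
    Finset.mem_biUnion.2 ⟨j, Finset.mem_univ j, List.mem_toFinset.2 hv⟩
  have hP₃card : P₃.card ≤ 3 * k := by
    have := Finset.card_biUnion_le_card_mul Finset.univ
      (fun j => ((Q j).take 3).toFinset) 3 fun j _ =>
        (List.toFinset_card_le _).trans (List.length_take_le 3 (Q j))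
    rw [Finset.card_fin] at this
    exact this.trans (by omega)
  have hSP : (S ∩ P).card ≤ k := by
    have hsub : S ∩ P ⊆ Finset.univ.image s := by
      intro v hv
      rw [Finset.mem_inter, hP] at hv
      obtain ⟨hvS, j, hj⟩ := hv
      have h := hQhead j v hj hvS
      rw [(hsQ j).2.2.1] at h
      exact Finset.mem_image.2 ⟨j, Finset.mem_univ j, by simpa using h⟩
    exact (Finset.card_le_card hsub).trans (Finset.card_image_le.trans (Finset.card_fin k).le)
  have hunused : ∀ t, t ∉ P → ∀ j, t ∉ Q j := fun t ht j h => ht ((hP t).2 ⟨j, h⟩)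
  have hone : ∀ t ∈ S, t ∉ P → ∀ v ∈ P, T.Adj t v → v ∈ P₃ := by
    intro t ht htP v hv htv
    obtain ⟨j, hj⟩ := (hP v).1 hv
    exact hP₃ j v (hQone t ht (hunused t htP) j v hj htv)
  have htwo : ∀ t ∈ S, t ∉ P → ∀ z, z ∉ P → z ∉ F → T.Adj t z → ∀ v ∈ P, T.Adj z v → v ∈ P₃ := by
    intro t ht htP z hzP hzF htz v hv hzv
    obtain ⟨j, hj⟩ := (hP v).1 hv
    exact hP₃ j v (hQtwo t ht (hunused t htP) z (by rintro rfl; exact hT.1 _ htz) hzF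
      (hunused z hzP) htz j v hj hzv)
  have hPF : ∀ v ∈ P, v ∉ F := by
    intro v hv
    obtain ⟨j, hj⟩ := (hP v).1 hv
    exact hQ.avoid j v hj
  have hxP : ∀ i, x i ∉ P := fun i h => hPF _ h (Finset.mem_union_left _ (hxX i))
  have hζP : ∀ i, ∀ z ∈ ζ i, z ∉ P := fun i z hz h =>
    hPF _ h (Finset.mem_union_right _ (hζZ i hz))
  -- Each index gets its own unused vertex of `S`.
  obtain ⟨σ, hσ, hσdisj⟩ := Finset.exists_pairwise_disjoint_family
    (fun i l => ∃ t ∈ S, t ∉ P ∧ (∀ z ∈ ζ i, T.Adj z t) ∧ l = {t}) 1 (by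
      intro i W hW
      rw [one_mul, Fintype.card_fin] at hW
      set B : Finset V := S.filter fun t => ∃ z ∈ ζ i, ¬ T.Adj z t
      have hB : B.card ≤ k := by
        rcases (hζ i).1 with ⟨z, hz, h⟩ | ⟨h, -⟩
        · simp only [hA, Finset.mem_filter] at hz
          simpa [B, h] using hz.2.2.2.2.2
        · simp [B, h]
      have h1 := Finset.card_union_le (S ∩ P ∪ B) W
      have h2 := Finset.card_union_le (S ∩ P) B
      -- Three sets of size at most `k` are excluded: used vertices, those missed by the reserved
      -- vertex, and hubs already assigned. Hence `4k` vertices in `S` suffice.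
      obtain ⟨t, ht, htn⟩ := Finset.exists_mem_notMem_of_card_lt_card
        (by omega : (S ∩ P ∪ B ∪ W).card < S.card)
      simp only [B, Finset.mem_union, Finset.mem_inter, Finset.mem_filter, ht, true_and, not_or,
        not_exists, not_and, not_not] at htn
      exact ⟨{t}, ⟨t, ht, htn.1.1, htn.1.2, rfl⟩, by simp, by simpa using htn.2⟩)
  set K : Finset V := X ∪ Y ∪ S ∪ Z ∪ P₃
  have hKcard : K.card ≤ 10 * k := by
    have h1 := Finset.card_union_le (X ∪ Y ∪ S ∪ Z) P₃
    have h2 := Finset.card_union_le (X ∪ Y ∪ S) Z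
    have h3 := Finset.card_union_le (X ∪ Y) S
    have h4 := Finset.card_union_le X Y
    exact h1.trans (by omega)
  have hKmem : ∀ v, v ∈ K ↔ (((v ∈ X ∨ v ∈ Y) ∨ v ∈ S) ∨ v ∈ Z) ∨ v ∈ P₃ := by
    simp [K, or_assoc]
  -- Short connections from `x i` to the initial vertex of `Q i`.
  obtain ⟨l, hl, hldisj⟩ := Finset.exists_pairwise_disjoint_family
    (fun i l => (∀ v ∈ l, v ∉ K ∧ v ∉ P) ∧ ∃ M : List V, M.Nodup ∧ M.head? = some (x i) ∧
      (M ++ [s i]).IsChain T.Adj ∧ ∀ v ∈ M, v ∈ l ∨ v = x i ∨ v ∈ σ i ∨ v ∈ ζ i) 3 (by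
    intro i W hW
    rw [Fintype.card_fin] at hW
    -- `10k` for `K` and `3k` for the other connections; the degree `100k` leaves ample room for `3
    -- * 13k + k + 5`.
    have hKW : (K ∪ W).card ≤ 13 * k := (Finset.card_union_le _ _).trans (by omega)
    have hK : ∀ v, v ∈ K → v ∈ K ∪ W := fun v hv => Finset.mem_union_left _ hv
    obtain ⟨⟨t, htS, htP, hζt, hσt⟩, -⟩ := hσ i
    have hsK : s i ∈ K ∪ W := hK _ ((hKmem _).2 (by simp [hsS i]))
    have htK : t ∈ K ∪ W := hK _ ((hKmem _).2 (by simp [htS]))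
    have hxK : x i ∈ K ∪ W := hK _ ((hKmem _).2 (by simp [hxX i]))
    have hxt : x i ≠ t := fun h => (hSX t htS).1 (h ▸ hxX i)
    have hmin : ∀ z, z ∉ K ∪ W → T.outDegree (s i) ≤ T.outDegree z := by
      intro z hz
      have hzK : z ∉ K := fun h => hz (hK z h)
      rw [hKmem] at hzK
      push Not at hzK
      exact hSmin _ (hsS i) z (by simp [hzK]) hzK.1.1.2
    have ht1 : ∀ v ∈ P, T.Adj t v → v ∈ K ∪ W := fun v hv h =>
      hK _ ((hKmem _).2 (Or.inr (hone t htS htP v hv h)))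
    have ht2 : ∀ z, z ∉ P → z ∉ K ∪ W → T.Adj t z → ∀ v ∈ P, T.Adj z v → v ∈ K ∪ W := by
      intro z hzP hzK htz v hv hzv
      refine hK _ ((hKmem _).2 (Or.inr (htwo t htS htP z hzP (fun h => hzK (hK _ ?_)) htz v hv hzv)))
      rcases Finset.mem_union.1 h with h | h
      · exact (hKmem _).2 (by simp [h])
      · exact (hKmem _).2 (by simp [h])
    have hdt := hdeg t
    have hdx := hdeg (x i)
    rcases (hζ i).1 with ⟨z, hzA, hz⟩ | ⟨-, hAk⟩
    · obtain ⟨l, hl, hlen, hlK, hchain⟩ :=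
        hT.exists_path_from_hub hsK hmin ht1 ht2 (by omega)
      have hzζ : z ∈ ζ i := by simp [hz]
      have hzZ := hZ z (hζZ i hzζ)
      have hxz : T.Adj (x i) z := (Finset.mem_filter.1 hzA).2.1
      have hnot : ∀ v ∈ K ∪ W, v ∉ l := fun v hv h => (hlK v h).1 hv
      have hzK : z ∈ K ∪ W := hK _ ((hKmem _).2 (by simp [hζZ i hzζ]))
      have hxz' : x i ≠ z := fun h => hzZ.1 (h ▸ hxX i)
      have hzt' : z ≠ t := fun h => hzZ.2.2 (h ▸ htS)
      refine ⟨l.toFinset, ⟨?_, x i :: z :: t :: l, ?_, rfl, ?_, ?_⟩, ?_, ?_⟩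
      · intro v hv
        have := hlK v (List.mem_toFinset.1 hv)
        exact ⟨fun h => this.1 (hK v h), this.2⟩
      · simp [hxz', hxt, hzt', hl, hnot _ hxK, hnot _ hzK, hnot _ htK]
      · simpa [hxz, hζt z hzζ] using hchain
      · intro v hv
        simp only [List.mem_cons] at hv
        rcases hv with rfl | rfl | rfl | hv
        · simp
        · simp [hzζ]
        · simp [hσt]
        · simp [hv]
      · exact l.toFinset_card_le.trans (by omega)
      · rw [Finset.disjoint_left]
        intro v hv hvW
        exact (hlK v (List.mem_toFinset.1 hv)).1 (Finset.mem_union_right _ hvW)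
    -- Outside `P₃` a vertex of `P` receives no edge from unused vertices of `S`, so it dominates
    -- all of them and misses at most the `k` used ones.
    · have hsub : {v | T.Adj (x i) v ∧ v ∈ P ∧ v ∉ K ∪ W} ⊆ (A i : Set V) := by
        rintro v ⟨hxv, hvP, hvK⟩
        have hvK' : v ∉ K := fun h => hvK (hK v h)
        rw [hKmem] at hvK'
        push Not at hvK'
        rw [Finset.mem_coe, hA, Finset.mem_filter]
        refine ⟨Finset.mem_univ v, hxv, hvK'.1.1.1.1, hvK'.1.1.1.2, hvK'.1.1.2, ?_⟩
        refine (Finset.card_le_card ?_).trans hSP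
        intro r hr
        rw [Finset.mem_filter] at hr
        rw [Finset.mem_inter]
        refine ⟨hr.1, ?_⟩
        by_contra hrP
        have hrv : T.Adj r v := hT.adj_of_not_adj (by rintro rfl; exact hrP hvP) hr.2
        exact hvK'.2 (hone r hr.1 hrP v hvP hrv)
      have hxk : {v | T.Adj (x i) v ∧ v ∈ P ∧ v ∉ K ∪ W}.ncard ≤ k := by
        refine (Set.ncard_le_ncard hsub (Set.toFinite _)).trans ?_
        rwa [Set.ncard_coe_finset]
      obtain ⟨l, hlen, hlK, M, hM, hMx, hMchain, hMmem⟩ :=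
        hT.exists_path_through_hub hxK hxt htK hsK hmin ht1 ht2 hxk (by omega) (by omega)
      refine ⟨l, ⟨fun v hv => ⟨fun h => (hlK v hv).1 (hK v h), (hlK v hv).2⟩,
        M, hM, hMx, hMchain, fun v hv => ?_⟩, hlen, ?_⟩
      · rcases hMmem v hv with h | h | h
        · exact Or.inl h
        · exact Or.inr (Or.inl h)
        · exact Or.inr (Or.inr (Or.inl (by simp [hσt, h])))
      · rw [Finset.disjoint_left]
        intro v hv hvW
        exact (hlK v hv).1 (Finset.mem_union_right _ hvW))
  have hlK : ∀ i, ∀ v ∈ l i, v ∉ K ∧ v ∉ P := fun i => (hl i).1.1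
  choose M hM hMx hMchain hMmem using fun i => (hl i).1.2
  have hσS : ∀ i, ∀ t ∈ σ i, t ∈ S ∧ t ∉ P := by
    intro i t ht
    obtain ⟨⟨t', h1, h2, -, h⟩, -⟩ := hσ i
    rw [h, Finset.mem_singleton] at ht
    exact ht ▸ ⟨h1, h2⟩
  have hMP : ∀ i, ∀ v ∈ M i, v ∉ P := by
    intro i v hv
    rcases hMmem i v hv with h | rfl | h | h
    · exact (hlK i v h).2
    · exact hxP i
    · exact (hσS i v h).2
    · exact hζP i v h
  have hQP : ∀ i, ∀ v ∈ Q i, v ∈ P := fun i v hv => (hP v).2 ⟨i, hv⟩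
  have hMM : ∀ i j, i ≠ j → (M i).Disjoint (M j) := by
    intro i j hij v hi hj
    have hKl : ∀ i, v ∈ l i → v ∉ X ∧ v ∉ S ∧ v ∉ Z := by
      intro i h
      have := (hlK i v h).1
      rw [hKmem] at this
      push Not at this
      exact ⟨this.1.1.1.1, this.1.1.2, this.1.2⟩
    have hXv : ∀ i, v = x i → v ∈ X := fun i h => h ▸ hxX i
    have hσv : ∀ i, v ∈ σ i → v ∈ S ∧ v ∉ X := fun i h =>
      ⟨(hσS i v h).1, (hSX v (hσS i v h).1).1⟩
    have hζv : ∀ i, v ∈ ζ i → v ∈ Z ∧ v ∉ X ∧ v ∉ S := fun i h =>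
      ⟨hζZ i h, (hZ v (hζZ i h)).1, (hZ v (hζZ i h)).2.2⟩
    have d1 : v ∈ l i → v ∉ l j := fun h => Finset.disjoint_left.1 (hldisj i j hij) h
    have d2 : v ∈ σ i → v ∉ σ j := fun h => Finset.disjoint_left.1 (hσdisj i j hij) h
    have d3 : v ∈ ζ i → v ∉ ζ j := fun h => Finset.disjoint_left.1 (hζdisj i j hij) h
    have d4 : v = x i → v ≠ x j := fun h h' => hij (hx (h.symm.trans h'))
    rcases hMmem i v hi with h | h | h | h <;> rcases hMmem j v hj with h' | h' | h' | h'
    · exact d1 h h'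
    · exact (hKl i h).1 (hXv j h')
    · exact (hKl i h).2.1 (hσv j h').1
    · exact (hKl i h).2.2 (hζv j h').1
    · exact (hKl j h').1 (hXv i h)
    · exact d4 h h'
    · exact (hσv j h').2 (hXv i h)
    · exact (hζv j h').2.1 (hXv i h)
    · exact (hKl j h').2.1 (hσv i h).1
    · exact (hσv i h).2 (hXv j h')
    · exact d2 h h'
    · exact (hζv j h').2.2 (hσv i h).1
    · exact (hKl j h').2.2 (hζv i h).1
    · exact (hζv i h).2.1 (hXv j h')
    · exact (hζv i h).2.2 (hσv j h').1
    · exact d3 h h'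
  refine ⟨fun i => M i ++ Q i, fun i => ⟨?_, ?_, ?_, ?_⟩, ?_⟩
  · refine List.nodup_append.2 ⟨hM i, (hsQ i).1, ?_⟩
    rintro v hv w hw rfl
    exact hMP i v hv (hQP i v hw)
  · obtain ⟨h1, -, h2⟩ := List.isChain_append.1 (hMchain i)
    refine List.isChain_append.2 ⟨h1, (hsQ i).2.1, fun u hu w hw => h2 u hu w ?_⟩
    rw [(hsQ i).2.2.1] at hw
    simpa using hw
  · rw [List.head?_append, hMx i]
    rfl
  · rw [List.getLast?_append, (hsQ i).2.2.2]
    rfl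
  · intro i j hij v hi hj
    rcases List.mem_append.1 hi with hi | hi <;> rcases List.mem_append.1 hj with hj | hj
    · exact hMM i j hij hi hj
    · exact hMP i v hi (hQP j v hj)
    · exact hMP j v hj (hQP i v hi)
    · exact hQ.disjoint i j hij hi hj

end Digraph

theorem theorem1p1 (k : ℕ) (hk : 0 < k) :
    ∃ f : ℕ, ∀ (V : Type*) [Finite V] (T : Digraph V), T.IsTournament →
      T.StronglyKConnected (4 * k) → f ≤ T.minOutDegree → T.KLinked k := by
  refine ⟨100 * k, fun V _ T hT hcon hf => ?_⟩
  exact hT.kLinked_of_stronglyKConnected hk (fun S hS => hcon S (by omega))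
    fun v => hf.trans (ciInf_le (OrderBot.bddBelow _) v)
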